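/- Let $(S_t)_{t\ge 0}$ be a simple random walk on $\mathbb{Z}$ started at $S_0=0$ (independent increments, each equal to $\pm1$ with probability $1/2$). For an integer $k\ge 1$, a $k$-excursion starting at $x\in\mathbb{Z}$ is a part of the trajectory that starts at a time $j$ with $S_j=x$, ends at the next time $m>j$ with $S_m=x$, and visits $x-k$ in between. Let $T(k,x,n)$ be the number of $k$-excursions starting at $x$ that are completed until time $n$ (that is, with $m\le n$). There are universal constants $d_3,c_3>0$ such that the following holds almost surely: there are infinitely many $n$ such that, for all integers $k\ge1$ with $k\le\frac{d_3\sqrt{n}}{2\sqrt{\log\log n}}$ and all real $l\ge 0$, $$\sum_{x\in\mathbb{Z}}\min\{T(k,x,n),l\}\ge c_3\min\left\{\frac{n}{k},\sqrt{n\log\log n}\;l\right\}.$$ -/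

import Mathlib

open MeasureTheory ProbabilityTheory Filter

/-- `S` is a simple random walk on `ℤ` under the measure `P`: it starts at `0` and its increments
are independent, each being `+1` or `-1` with probability `1/2`. -/
structure IsSimpleRandomWalk {Ω : Type*} [MeasurableSpace Ω] (P : Measure Ω)
    (S : ℕ → Ω → ℤ) : Prop where
  measurable : ∀ t, Measurable (S t)
  start : ∀ᵐ ω ∂P, S 0 ω = 0
  indep : iIndepFun (fun t ω => S (t + 1) ω - S t ω) P
  step_up : ∀ t, P {ω | S (t + 1) ω - S t ω = 1} = 1 / 2
  step_down : ∀ t, P {ω | S (t + 1) ω - S t ω = -1} = 1 / 2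

/-- The trajectory `s` performs a `k`-excursion that begins at time `j` and is completed at
time `m`: `m` is the time of the first return to `s j` after time `j`, and the trajectory visits
`s j - k` in between. -/
def IsExcursion (s : ℕ → ℤ) (k j m : ℕ) : Prop :=
  j < m ∧ s m = s j ∧ (∀ t, j < t → t < m → s t ≠ s j) ∧
    ∃ i, j < i ∧ i < m ∧ s i = s j - (k : ℤ)

/-- `excursionCount s k x n` is the number `T(k, x, n)` of `k`-excursions of the trajectory `s`
starting at the point `x` that are completed until time `n`. Excursions are counted through their
starting times (a finite set, as these are less than `n`). -/
noncomputable def excursionCount (s : ℕ → ℤ) (k : ℕ) (x : ℤ) (n : ℕ) : ℕ :=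
  Set.ncard {j : ℕ | s j = x ∧ ∃ m, m ≤ n ∧ IsExcursion s k j m}

/-- The truncated sum `∑ x, min (T(k, x, n)) l` over all `x : ℤ`. For `l ≥ 0` only the finitely
many points visited before time `n` contribute. -/
noncomputable def truncatedSum (s : ℕ → ℤ) (k n : ℕ) (l : ℝ) : ℝ :=
  ∑' x : ℤ, min (excursionCount s k x n : ℝ) l

/-! Fix a scale `N`. Within a large multiple of `N²` steps the walk returns `N` times to its current
point with probability close to 1, and each excursion reaches depth `k` with probability `1/(2k)`.
So a freshly hit point soon carries at least `N/(16k)` many `k`-excursions, for all `k ≤ N/2^14` at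
once. Averaging over points, a block of `8(768N)²` steps has probability at least `1/48` to end at
least `768N` higher with half of the next `768N` levels rich in this sense
(`wordProb_climbingBlock_ge`).

Stacking `q` such blocks costs a factor `48^(-q)` and yields at least `384qN` distinct rich points
in time of order `qN²`. The times from `2^j` to `2^(j+1)` have room for `q = ⌊log₄₈ j⌋` blocks with
`qN²` of order `n = 2^(j+1)`. Such a stage succeeds with probability at least `1/j` and the stages
are independent, so the second Borel–Cantelli lemma gives infinitely many successes
(`ae_frequently_climbingBlocks`). Since `q` is of order `log log n`, `qN` is of order `√(n log log
n)`, and `384qN · min(N/(16k), l)` dominates the claimed bound for all `k` and `l` simultaneously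
(`truncatedSum_ge_of_climbingBlocks`).

Probabilities are computed on finite words of signs, where conditioning on the first step turns
estimates into inductions; `measureReal_stepWord` transfers them to the walk. -/

/-! ### Finite probability on words of steps -/

/-- The average of `f` over all words of length `u` over the alphabet `Bool`. -/
noncomputable def wordMean : ℕ → (List Bool → ℝ) → ℝ
  | 0, f => f []
  | u + 1, f => (wordMean u (fun w => f (true :: w)) + wordMean u (fun w => f (false :: w))) / 2

/-- The proportion of the words of length `u` that lie in `A`. -/
noncomputable def wordProb (u : ℕ) (A : Set (List Bool)) : ℝ := wordMean u (A.indicator 1)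

/-- The step of the walk encoded by a letter. -/
def stepValue (b : Bool) : ℤ := if b then 1 else -1

@[simp] lemma stepValue_true : stepValue true = 1 := rfl
@[simp] lemma stepValue_false : stepValue false = -1 := rfl

/-- The displacement of the walk whose steps are the letters of `w`. -/
def displacement (w : List Bool) : ℤ := (w.map stepValue).sum

@[simp] lemma displacement_nil : displacement [] = 0 := rfl
@[simp] lemma displacement_cons (b : Bool) (w : List Bool) :
    displacement (b :: w) = stepValue b + displacement w := by simp [displacement]
@[simp] lemma displacement_map_not (w : List Bool) :
    displacement (w.map not) = -displacement w := by
  induction w with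
  | nil => simp
  | cons b w ih => cases b <;> simp [ih] <;> ring

lemma wordMean_mono {u : ℕ} {f g : List Bool → ℝ} (h : ∀ w, w.length = u → f w ≤ g w) :
    wordMean u f ≤ wordMean u g := by
  induction u generalizing f g with
  | zero => exact h [] rfl
  | succ u ih =>
    have h₁ := ih (f := fun w => f (true :: w)) (g := fun w => g (true :: w))
      fun w hw => h _ (by simp [hw])
    have h₂ := ih (f := fun w => f (false :: w)) (g := fun w => g (false :: w))
      fun w hw => h _ (by simp [hw])
    simp only [wordMean]
    linarith

lemma wordMean_congr {u : ℕ} {f g : List Bool → ℝ} (h : ∀ w, w.length = u → f w = g w) :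
    wordMean u f = wordMean u g :=
  le_antisymm (wordMean_mono fun w hw => (h w hw).le) (wordMean_mono fun w hw => (h w hw).ge)

lemma wordMean_const (u : ℕ) (c : ℝ) : wordMean u (fun _ => c) = c := by
  induction u with
  | zero => rfl
  | succ u ih => simp [wordMean, ih]

lemma wordMean_add (u : ℕ) (f g : List Bool → ℝ) :
    wordMean u (fun w => f w + g w) = wordMean u f + wordMean u g := by
  induction u generalizing f g with
  | zero => rfl
  | succ u ih => simp only [wordMean, ih]; ring

lemma wordMean_const_mul (u : ℕ) (c : ℝ) (f : List Bool → ℝ) :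
    wordMean u (fun w => c * f w) = c * wordMean u f := by
  induction u generalizing f with
  | zero => rfl
  | succ u ih => simp only [wordMean, ih]; ring

lemma wordMean_mul_const (u : ℕ) (c : ℝ) (f : List Bool → ℝ) :
    wordMean u (fun w => f w * c) = wordMean u f * c := by
  simp_rw [mul_comm _ c, wordMean_const_mul]

lemma wordMean_sum (u : ℕ) {ι : Type*} (s : Finset ι) (f : ι → List Bool → ℝ) :
    wordMean u (fun w => ∑ i ∈ s, f i w) = ∑ i ∈ s, wordMean u (f i) := by
  classical
  induction s using Finset.induction_on with
  | empty => simp [wordMean_const]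
  | insert a s ha ih => simp only [Finset.sum_insert ha, wordMean_add, ih]

lemma wordMean_append (m n : ℕ) (f : List Bool → ℝ) :
    wordMean (m + n) f = wordMean m (fun v => wordMean n (fun w => f (v ++ w))) := by
  induction m generalizing f with
  | zero => simp [wordMean]
  | succ m ih => rw [Nat.succ_add]; simp only [wordMean, ih, List.cons_append]

lemma wordMean_map_not (u : ℕ) (f : List Bool → ℝ) :
    wordMean u (fun w => f (w.map not)) = wordMean u f := by
  induction u generalizing f with
  | zero => rfl
  | succ u ih =>
    simp only [wordMean, List.map_cons, Bool.not_true, Bool.not_false]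
    rw [ih (fun w => f (false :: w)), ih (fun w => f (true :: w)), add_comm]

lemma wordProb_zero (A : Set (List Bool)) : wordProb 0 A = A.indicator 1 [] := rfl

lemma wordProb_succ (u : ℕ) (A : Set (List Bool)) :
    wordProb (u + 1) A =
      (wordProb u {w | true :: w ∈ A} + wordProb u {w | false :: w ∈ A}) / 2 := rfl

lemma wordProb_mono {u : ℕ} {A B : Set (List Bool)} (h : ∀ w, w.length = u → w ∈ A → w ∈ B) :
    wordProb u A ≤ wordProb u B := by
  refine wordMean_mono fun w hw => ?_
  by_cases hA : w ∈ A
  · simp [hA, h w hw hA]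
  · rw [Set.indicator_of_notMem hA]
    exact Set.indicator_nonneg (fun _ _ => zero_le_one) w

lemma wordProb_nonneg (u : ℕ) (A : Set (List Bool)) : 0 ≤ wordProb u A := by
  rw [← wordMean_const u 0]
  exact wordMean_mono fun w _ => Set.indicator_nonneg (fun _ _ => zero_le_one) w

lemma wordProb_univ (u : ℕ) : wordProb u Set.univ = 1 := by
  simp only [wordProb, Set.indicator_univ]
  exact wordMean_const u 1

lemma wordProb_le_one (u : ℕ) (A : Set (List Bool)) : wordProb u A ≤ 1 := by
  rw [← wordProb_univ u]
  exact wordProb_mono fun w _ _ => Set.mem_univ w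

lemma wordProb_union_le (u : ℕ) (A B : Set (List Bool)) :
    wordProb u (A ∪ B) ≤ wordProb u A + wordProb u B := by
  rw [wordProb, wordProb, wordProb, ← wordMean_add]
  refine wordMean_mono fun w _ => ?_
  by_cases hA : w ∈ A <;> by_cases hB : w ∈ B <;> simp [hA, hB]

lemma wordProb_biUnion_le (u : ℕ) {ι : Type*} (s : Finset ι) (A : ι → Set (List Bool)) :
    wordProb u (⋃ i ∈ s, A i) ≤ ∑ i ∈ s, wordProb u (A i) := by
  classical
  induction s using Finset.induction_on with
  | empty => simp [wordProb, wordMean_const, Set.indicator_empty]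
  | insert a s ha ih =>
    rw [Finset.set_biUnion_insert, Finset.sum_insert ha]
    exact (wordProb_union_le _ _ _).trans (by gcongr)

lemma mul_wordProb_le {u : ℕ} {c : ℝ} {f : List Bool → ℝ} {A : Set (List Bool)}
    (hf : ∀ w, 0 ≤ f w) (h : ∀ w, w.length = u → w ∈ A → c ≤ f w) :
    c * wordProb u A ≤ wordMean u f := by
  rw [wordProb, ← wordMean_const_mul]
  refine wordMean_mono fun w hw => ?_
  by_cases hA : w ∈ A
  · simpa [hA] using h w hw hA
  · simpa [hA] using hf w

/-- The first `m` and the last `n` letters of a random word are independent. -/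
lemma wordProb_take_drop (m n : ℕ) (A B : Set (List Bool)) :
    wordProb (m + n) {w | w.take m ∈ A ∧ w.drop m ∈ B} = wordProb m A * wordProb n B := by
  rw [wordProb, wordMean_append]
  rw [show wordProb m A * wordProb n B = wordMean m (fun v => A.indicator 1 v * wordProb n B) from
    (wordMean_mul_const _ _ _).symm]
  refine wordMean_congr fun v hv => ?_
  rw [wordProb, ← wordMean_const_mul]
  refine wordMean_congr fun w hw => ?_
  by_cases hA : v ∈ A <;> by_cases hB : w ∈ B <;> simp [← hv, hA, hB]

lemma wordProb_map_not (u : ℕ) (A : Set (List Bool)) :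
    wordProb u {w | w.map not ∈ A} = wordProb u A :=
  wordMean_map_not u (A.indicator 1)

/-! ### Moments and tails of the displacement -/

lemma wordMean_sq (u : ℕ) (s : ℝ) :
    wordMean u (fun w => (s + displacement w) ^ 2) = s ^ 2 + u := by
  induction u generalizing s with
  | zero => simp [wordMean]
  | succ u ih =>
    have h := ih (s + 1)
    have h' := ih (s - 1)
    simp only [wordMean, displacement_cons, stepValue_true, stepValue_false]
    push_cast
    simp only [← add_assoc, ← sub_eq_add_neg]
    rw [h, h']
    ring

lemma wordMean_pow_four (u : ℕ) (s : ℝ) :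
    wordMean u (fun w => (s + displacement w) ^ 4) =
      s ^ 4 + 6 * s ^ 2 * u + 3 * u ^ 2 - 2 * u := by
  induction u generalizing s with
  | zero => simp [wordMean]
  | succ u ih =>
    have h := ih (s + 1)
    have h' := ih (s - 1)
    simp only [wordMean, displacement_cons, stepValue_true, stepValue_false]
    push_cast
    simp only [← add_assoc, ← sub_eq_add_neg]
    rw [h, h']
    ring

/-- Moment method: with `y` the squared displacement, `(y - h²)(20h² - y)` is nonpositive off the
event, at most `96h⁴` everywhere, and has mean at least `16h⁴` after `4h²` steps. -/
lemma one_sixth_le_wordProb_abs {h : ℕ} (hh : 0 < h) :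
    1 / 6 ≤ wordProb (4 * h ^ 2) {w | (h : ℤ) ≤ |displacement w|} := by
  have h₂ := wordMean_sq (4 * h ^ 2) 0
  have h₄ := wordMean_pow_four (4 * h ^ 2) 0
  have hpos : (0 : ℝ) < h := by exact_mod_cast hh
  have key : wordMean (4 * h ^ 2) (fun w => 21 * (h : ℝ) ^ 2 * (0 + displacement w) ^ 2 +
      (-1 * (0 + displacement w) ^ 4 + -20 * (h : ℝ) ^ 4)) ≤
      96 * (h : ℝ) ^ 4 * wordProb (4 * h ^ 2) {w | (h : ℤ) ≤ |displacement w|} := by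
    rw [wordProb, ← wordMean_const_mul]
    refine wordMean_mono fun w _ => ?_
    by_cases hw : (h : ℤ) ≤ |displacement w|
    · rw [Set.indicator_of_mem (by exact hw)]
      simp only [Pi.one_apply]
      nlinarith [sq_nonneg (2 * (displacement w : ℝ) ^ 2 - 21 * (h : ℝ) ^ 2), pow_pos hpos 4]
    · rw [Set.indicator_of_notMem (by exact hw)]
      have h₁ : |(displacement w : ℝ)| < h := by exact_mod_cast not_le.mp hw
      have h₃ : (displacement w : ℝ) ^ 2 < (h : ℝ) ^ 2 := sq_lt_sq' (abs_lt.mp h₁).1 (abs_lt.mp h₁).2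
      nlinarith
  rw [wordMean_add, wordMean_add, wordMean_const_mul, wordMean_const_mul, h₂, h₄,
    wordMean_const] at key
  push_cast at key
  have h1 : (1 : ℝ) ≤ h := by exact_mod_cast hh
  have : 16 * (h : ℝ) ^ 4 ≤
      96 * (h : ℝ) ^ 4 * wordProb (4 * h ^ 2) {w | (h : ℤ) ≤ |displacement w|} := by
    nlinarith [sq_nonneg (h : ℝ)]
  have h4 := pow_pos hpos 4
  by_contra hc
  push Not at hc
  nlinarith [mul_lt_mul_of_pos_left hc (by positivity : 0 < 96 * (h : ℝ) ^ 4)]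

lemma one_twelfth_le_wordProb {h : ℕ} (hh : 0 < h) :
    1 / 12 ≤ wordProb (4 * h ^ 2) {w | (h : ℤ) ≤ displacement w} := by
  have h₁ := one_sixth_le_wordProb_abs hh
  have h₂ := wordProb_map_not (4 * h ^ 2) {w | (h : ℤ) ≤ displacement w}
  have h₃ : wordProb (4 * h ^ 2) {w | (h : ℤ) ≤ |displacement w|} ≤ _ :=
    (wordProb_mono (B := {w | (h : ℤ) ≤ displacement w} ∪
      {w | w.map not ∈ {w | (h : ℤ) ≤ displacement w}}) fun w _ hw => by
        simpa [le_abs] using hw).trans (wordProb_union_le _ _ _)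
  linarith

lemma one_half_le_wordProb (u : ℕ) :
    1 / 2 ≤ wordProb u {w | 0 ≤ displacement w} := by
  have h₂ := wordProb_map_not u {w | 0 ≤ displacement w}
  have h₃ : wordProb u Set.univ ≤ _ :=
    (wordProb_mono (B := {w | 0 ≤ displacement w} ∪
      {w | w.map not ∈ {w | 0 ≤ displacement w}}) fun w _ hw => by
        simpa using le_total 0 (displacement w)).trans (wordProb_union_le _ _ _)
  rw [wordProb_univ] at h₃
  linarith

/-! ### Visits to a point and deep excursions from it -/

/-- The number of visits to `0`, after time `0`, of the walk started at `s` with steps `w`. -/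
def visits : ℤ → List Bool → ℕ
  | _, [] => 0
  | s, b :: w => (if s + stepValue b = 0 then 1 else 0) + visits (s + stepValue b) w

/-- The number of returns to `0`, preceded by a visit below `-k` since the last visit to `0`, of
the walk started at `s` with steps `w`. The flag tells whether such a visit below `-k` took place
before time `0`. -/
def returnsFrom (k : ℕ) : ℤ → Bool → List Bool → ℕ
  | _, _, [] => 0
  | s, f, b :: w =>
    if s + stepValue b = 0 then (if f then 1 else 0) + returnsFrom k 0 false w
    else returnsFrom k (s + stepValue b) (f || decide (s + stepValue b ≤ -k)) w

lemma returnsFrom_anti {k k' : ℕ} (hk : k ≤ k') (s : ℤ) (f f' : Bool) (hf : f' = true → f = true)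
    (w : List Bool) : returnsFrom k' s f' w ≤ returnsFrom k s f w := by
  induction w generalizing s f f' with
  | nil => simp [returnsFrom]
  | cons b w ih =>
    simp only [returnsFrom]
    split_ifs with h h₁ h₂
    · exact Nat.add_le_add_left (ih _ _ _ id) _
    · exact absurd (hf h₁) h₂
    · have := ih 0 false false id; omega
    · exact Nat.add_le_add_left (ih _ _ _ id) _
    · apply ih
      simp only [Bool.or_eq_true, decide_eq_true_eq]
      rintro (h' | h')
      · exact Or.inl (hf h')
      · right; omega

/-- The Laplace transform of the time of the `N`-th visit to `0` from `s`, in terms of the Laplace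
transform `r` of the time of the first visit to `0` from `1` and the discount factor `a`. -/
noncomputable def visitTransform (a r : ℝ) (s : ℤ) : ℕ → ℝ
  | 0 => 1
  | N + 1 => if s = 0 then (a * r) ^ (N + 1) else r ^ s.natAbs * (a * r) ^ N

/-- By `har`, `a(r^m + r^(m+2))/2 = r^(m+1)`, so `r^|s|` is reproduced by a discounted step away
from `0`. A step into `0` uses up one of the visits. -/
lemma visitTransform_step {a r : ℝ} (har : a * (1 + r ^ 2) = 2 * r) (s : ℤ) (N : ℕ) :
    visitTransform a r s (N + 1) =
      a * ((visitTransform a r (s + 1) (if s + 1 = 0 then N else N + 1) +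
        visitTransform a r (s + -1) (if s + -1 = 0 then N else N + 1)) / 2) := by
  have h0 : ∀ N, visitTransform a r 0 N = (a * r) ^ N := by
    intro N; cases N <;> simp [visitTransform]
  have h1 : ∀ (s : ℤ) N, s ≠ 0 → visitTransform a r s (N + 1) = r ^ s.natAbs * (a * r) ^ N := by
    intro s N hs; simp [visitTransform, hs]
  rcases lt_trichotomy s 0 with hs | rfl | hs
  · obtain ⟨m, rfl⟩ : ∃ m : ℕ, s = -(m + 1 : ℤ) := ⟨(-s - 1).toNat, by omega⟩
    rcases Nat.eq_zero_or_pos m with rfl | hm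
    · norm_num [h0, h1]
      linear_combination (-(a * r) ^ N / 2) * har
    · rw [if_neg (by omega), if_neg (by omega), h1 _ _ (by omega), h1 _ _ (by omega),
        h1 _ _ (by omega), show (-(m + 1 : ℤ)).natAbs = m + 1 by omega,
        show (-(m + 1 : ℤ) + 1).natAbs = m by omega,
        show (-(m + 1 : ℤ) + -1).natAbs = m + 2 by omega]
      linear_combination (-r ^ m * (a * r) ^ N / 2) * har
  · norm_num [h0, h1]
    ring
  · obtain ⟨m, rfl⟩ : ∃ m : ℕ, s = (m + 1 : ℤ) := ⟨(s - 1).toNat, by omega⟩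
    rcases Nat.eq_zero_or_pos m with rfl | hm
    · norm_num [h0, h1]
      linear_combination (-(a * r) ^ N / 2) * har
    · rw [if_neg (by omega), if_neg (by omega), h1 _ _ (by omega), h1 _ _ (by omega),
        h1 _ _ (by omega), show ((m + 1 : ℤ)).natAbs = m + 1 by omega,
        show ((m + 1 : ℤ) + 1).natAbs = m + 2 by omega,
        show ((m + 1 : ℤ) + -1).natAbs = m by omega]
      linear_combination (-r ^ m * (a * r) ^ N / 2) * har

/-- If `τ` is the time of the `N`-th visit, then `a^τ` is at most `1` when `τ ≤ u` and at most `a^u`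
otherwise; the inequality is the mean of this. -/
lemma visitTransform_le {a r : ℝ} (ha0 : 0 ≤ a) (ha1 : a ≤ 1) (hr0 : 0 ≤ r) (hr1 : r ≤ 1)
    (har : a * (1 + r ^ 2) = 2 * r) (u : ℕ) (s : ℤ) (N : ℕ) :
    visitTransform a r s N ≤ 1 - (1 - a ^ u) * wordProb u {w | visits s w < N} := by
  induction u generalizing s N with
  | zero =>
    have h2 : a * r ≤ 1 := mul_le_one₀ ha1 hr0 hr1
    have : visitTransform a r s N ≤ 1 := by
      cases N with
      | zero => simp [visitTransform]
      | succ N =>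
        simp only [visitTransform]
        split_ifs
        · exact pow_le_one₀ (by positivity) h2
        · exact mul_le_one₀ (pow_le_one₀ hr0 hr1) (by positivity) (pow_le_one₀ (by positivity) h2)
    simpa using this
  | succ u ih =>
    cases N with
    | zero => simp [visitTransform, wordProb, wordMean_const]
    | succ N =>
      have hset : ∀ b : Bool, {w | b :: w ∈ {w | visits s w < N + 1}} =
          {w | visits (s + stepValue b) w < if s + stepValue b = 0 then N else N + 1} := by
        intro b; ext w
        simp only [Set.mem_ofPred_eq, visits]
        split_ifs <;> omega
      have h₁ := ih (s + 1) (if s + 1 = 0 then N else N + 1)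
      have h₂ := ih (s + -1) (if s + -1 = 0 then N else N + 1)
      have hp := wordProb_le_one u {w | visits (s + 1) w < if s + 1 = 0 then N else N + 1}
      have hq := wordProb_le_one u {w | visits (s + -1) w < if s + -1 = 0 then N else N + 1}
      rw [visitTransform_step har, wordProb_succ, hset, hset]
      change _ ≤ 1 - (1 - a ^ (u + 1)) *
        ((wordProb u {w | visits (s + 1) w < if s + 1 = 0 then N else N + 1} +
        wordProb u {w | visits (s + -1) w < if s + -1 = 0 then N else N + 1}) / 2)
      generalize wordProb u {w | visits (s + 1) w < if s + 1 = 0 then N else N + 1} = p at *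
      generalize wordProb u {w | visits (s + -1) w < if s + -1 = 0 then N else N + 1} = q at *
      calc _ ≤ a * ((1 - (1 - a ^ u) * p + (1 - (1 - a ^ u) * q)) / 2) := by gcongr
        _ ≤ _ := by
          rw [pow_succ]
          nlinarith [mul_nonneg (sub_nonneg.2 ha1) (sub_nonneg.2 hp),
            mul_nonneg (sub_nonneg.2 ha1) (sub_nonneg.2 hq)]

/-- A walk of at least `4 * h ^ 2` steps visits its starting point at least `N` times, up to a
probability of order `N / h`. -/
lemma wordProb_visits_lt_le {h u : ℕ} (hh : 2 ≤ h) (hu : 4 * h ^ 2 ≤ u) (N : ℕ) :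
    wordProb u {w | visits 0 w < N} ≤ 4 * N / h := by
  have hh' : (2 : ℝ) ≤ h := by exact_mod_cast hh
  obtain ⟨e, he⟩ : ∃ e : ℝ, e = 1 / h := ⟨_, rfl⟩
  have he0 : 0 < e := by rw [he]; positivity
  have he1 : e ≤ 1 / 2 := by rw [he]; gcongr
  have heh : e * h = 1 := by rw [he]; field_simp
  -- With `r = 1 - 1/h`, the discount `a` lies between `1 - 1/h²` and `1 - 1/(2h²)`: `4h²` steps
  -- cost a factor of at most `e^(-2)`, whereas a visit costs only `a * r ≥ 1 - 2/h`, so Bernoulli's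
  -- inequality bounds `(a * r)^N` below.
  obtain ⟨r, hr⟩ : ∃ r : ℝ, r = 1 - e := ⟨_, rfl⟩
  obtain ⟨a, ha⟩ : ∃ a : ℝ, a = 2 * r / (1 + r ^ 2) := ⟨_, rfl⟩
  have hr0 : 0 ≤ r := by linarith
  have hr1 : r ≤ 1 := by linarith
  have hden : 0 < 1 + r ^ 2 := by positivity
  have har : a * (1 + r ^ 2) = 2 * r := by rw [ha]; field_simp
  have ha0 : 0 ≤ a := by rw [ha]; positivity
  have ha1 : a ≤ 1 := by rw [ha, div_le_one hden]; nlinarith [sq_nonneg (1 - r)]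
  have ha_ub : a ≤ 1 - e ^ 2 / 2 := by
    rw [ha, div_le_iff₀ hden, hr]; nlinarith [mul_pos he0 he0, mul_nonneg (mul_pos he0 he0).le
      (sub_nonneg.2 he1)]
  have ha_lb : 1 - e ^ 2 ≤ a := by
    rw [ha, le_div_iff₀ hden, hr]; nlinarith [mul_pos he0 he0, mul_nonneg (mul_pos he0 he0).le
      (sub_nonneg.2 he1), sq_nonneg (e * (1 - e))]
  have hau : a ^ u ≤ 1 / 2 := by
    have h1 : a ≤ Real.exp (-(e ^ 2 / 2)) := by
      have := Real.add_one_le_exp (-(e ^ 2 / 2)); linarith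
    calc a ^ u ≤ a ^ (4 * h ^ 2) := pow_le_pow_of_le_one ha0 ha1 hu
      _ ≤ Real.exp (-(e ^ 2 / 2)) ^ (4 * h ^ 2) := by gcongr
      _ = Real.exp (-2) := by
        rw [← Real.exp_nat_mul]; congr 1; push_cast
        linear_combination (-2 * (e * h + 1)) * heh
      _ ≤ 1 / 2 := by
        rw [Real.exp_neg, one_div]
        gcongr
        have := Real.add_one_le_exp (2 : ℝ); linarith
  have hT : visitTransform a r 0 N = (a * r) ^ N := by cases N <;> simp [visitTransform]
  have hmain := visitTransform_le ha0 ha1 hr0 hr1 har u 0 N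
  rw [hT] at hmain
  have hbern := one_add_mul_le_pow (a := a * r - 1) (by nlinarith [mul_nonneg ha0 hr0]) N
  rw [add_sub_cancel] at hbern
  have hP := wordProb_nonneg u {w | visits 0 w < N}
  have har_lb : 1 - 2 * e ≤ a * r := by
    have := mul_le_mul_of_nonneg_right ha_lb hr0
    rw [hr] at this ⊢; nlinarith [mul_pos he0 he0]
  have hN : (0 : ℝ) ≤ N := N.cast_nonneg
  have : wordProb u {w | visits 0 w < N} ≤ 4 * N * e := by
    nlinarith [mul_le_mul_of_nonneg_left har_lb hN]
  rw [he] at this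
  calc _ ≤ _ := this
    _ = _ := by ring

/-- The bound for the joint generating function of `returnsFrom k` and `visits`, as a function of
the starting point and the flag. -/
noncomputable def returnPotential (k : ℕ) (ρ : ℝ) (s : ℤ) (f : Bool) : ℝ :=
  if s = 0 then 1 else if f then ρ / 2 else if 0 < s then ρ else ρ * (1 + s / (2 * k))

/-- The potential is a supermartingale for the weight. From `s < 0` the walk reaches `-k` before `0`
with probability `|s|/k`, which halves the weight at the next return; hence the factor `1 + s/(2k)`.
An excursion multiplies the weight by `1 - 1/(4k)` on average, which `ρ` compensates. The factor `2`
covers the final time, since the potential is at least `1/2`. -/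
lemma wordMean_returnsFrom_le {k : ℕ} {ρ : ℝ} (hk : 1 ≤ k) (hρ : ρ * (1 - 1 / (4 * k)) = 1)
    (u : ℕ) (s : ℤ) (f : Bool) (hf : f = true → s ≠ 0) (hs : f = true ∨ -(k : ℤ) < s) :
    wordMean u (fun w => (1 / 2) ^ returnsFrom k s f w * ρ ^ visits s w) ≤
      2 * returnPotential k ρ s f := by
  have hk' : (1 : ℝ) ≤ k := by exact_mod_cast hk
  have hk1 : 1 / (4 * (k : ℝ)) ≤ 1 / 4 := by
    rw [div_le_div_iff₀ (by positivity) (by norm_num)]; linarith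
  have hk0 : 0 < 1 / (4 * (k : ℝ)) := by positivity
  have hρ1 : 1 ≤ ρ := by
    by_contra h; push Not at h; nlinarith
  induction u generalizing s f with
  | zero =>
    simp only [wordMean, returnsFrom, visits, pow_zero, mul_one, returnPotential]
    split_ifs with h1 h2 h3
    · norm_num
    · linarith
    · linarith
    · have h4 : -(k : ℝ) < s := by
        have := hs.resolve_left h2; exact_mod_cast this
      have : -(1 / 2) ≤ (s : ℝ) / (2 * k) := by
        rw [le_div_iff₀ (by positivity)]; linarith
      nlinarith
  | succ u ih =>
    -- `F` is the potential after one step, including the factors `ρ` and possibly `1/2` collected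
    -- on landing at `0`.
    obtain ⟨F, hF⟩ : ∃ F : ℤ → ℝ, ∀ t, F t = if t = 0 then (if f then ρ / 2 else ρ) else
      returnPotential k ρ t (f || decide (t ≤ -k)) := ⟨_, fun _ => rfl⟩
    have step : ∀ b : Bool, wordMean u (fun w => (1 / 2) ^ returnsFrom k s f (b :: w) *
        ρ ^ visits s (b :: w)) ≤ 2 * F (s + stepValue b) := by
      intro b
      rw [hF]
      simp only [returnsFrom, visits]
      by_cases h : s + stepValue b = 0
      · simp only [h, if_true]
        have h0 := ih 0 false (by simp) (Or.inr (by omega))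
        have h00 : returnPotential k ρ 0 false = 1 := by simp [returnPotential]
        rw [h00] at h0
        cases f
        · simp only [Bool.false_eq_true, if_false, zero_add]
          simp_rw [pow_add, pow_one, mul_left_comm _ ρ]
          rw [wordMean_const_mul]
          nlinarith
        · simp only [if_true]
          simp_rw [pow_add, pow_one, mul_mul_mul_comm _ _ ρ]
          rw [wordMean_const_mul]
          nlinarith
      · simp only [h, if_false, zero_add]
        apply ih _ _ (fun _ => h)
        simp only [Bool.or_eq_true, decide_eq_true_eq]
        by_cases h' : s + stepValue b ≤ -k
        · exact Or.inl (Or.inr h')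
        · exact Or.inr (not_le.mp h')
    suffices hV : (F (s + 1) + F (s + -1)) / 2 ≤ returnPotential k ρ s f by
      have h₁ := step true
      have h₂ := step false
      simp only [stepValue_true, stepValue_false] at h₁ h₂
      simp only [wordMean]
      linarith
    rw [hF, hF]
    clear step ih
    have hk2 : (k : ℝ) ≠ 0 := by positivity
    cases f
    · have hs' : -(k : ℤ) < s := by simpa using hs
      simp only [returnPotential, Bool.false_or, Bool.false_eq_true, if_false, decide_eq_true_eq]
      rcases lt_trichotomy s 0 with h | rfl | h
      · rw [if_neg (by omega : ¬ s + 1 ≤ -k), if_neg (by omega : ¬ s + -1 = 0),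
          if_neg (by omega : ¬ 0 < s + 1), if_neg (by omega : ¬ 0 < s + -1),
          if_neg (by omega : ¬ s = 0), if_neg (by omega : ¬ 0 < s), if_neg (by omega : ¬ s + -1 = 0)]
        have e1 : (if s + 1 = 0 then ρ else if s + 1 = 0 then 1 else
            ρ * (1 + ((s + 1 : ℤ) : ℝ) / (2 * k))) = ρ * (1 + (s + 1) / (2 * k)) := by
          split_ifs with h3
          · have : (s : ℝ) + 1 = 0 := by exact_mod_cast h3
            simp [this]
          · push_cast; rfl
        -- At `-k` the linear branch takes the value `ρ / 2`, so it agrees with the flagged branch.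
        have e2 : (if s + -1 ≤ -(k : ℤ) then ρ / 2 else ρ * (1 + ((s + -1 : ℤ) : ℝ) / (2 * k))) =
            ρ * (1 + (s - 1) / (2 * k)) := by
          split_ifs with h3
          · have : (s : ℝ) = -k + 1 := by
              have : s = -k + 1 := by omega
              rw [this]; push_cast; ring
            rw [this]; field_simp; ring
          · push_cast; rfl
        rw [e1, e2]
        apply le_of_eq; field_simp; ring
      · have h1 : ¬ (1 : ℤ) ≤ -k := by omega
        norm_num [h1]
        have e2 : (if k ≤ 1 then ρ / 2 else ρ * (1 + -1 / (2 * k))) =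
            ρ * (1 - 1 / (2 * k)) := by
          split_ifs with h3
          · have : (k : ℝ) = 1 := by
              exact_mod_cast le_antisymm h3 hk
            rw [this]; ring
          · ring
        rw [e2]
        have : ρ + ρ * (1 - 1 / (2 * (k : ℝ))) = 2 * (ρ * (1 - 1 / (4 * k))) := by
          field_simp; ring
        rw [this, hρ]; norm_num
      · rw [if_neg (by omega : ¬ s + 1 = 0), if_neg (by omega : ¬ s + 1 = 0),
          if_neg (by omega : ¬ s + 1 ≤ -k), if_pos (by omega : 0 < s + 1),
          if_neg (by omega : ¬ s = 0), if_pos h, if_neg (by omega : ¬ s + -1 ≤ -k)]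
        split_ifs with h3 h4
        · linarith
        · linarith
        · omega
    · have hs0 := hf rfl
      simp only [returnPotential, Bool.true_or, if_true, hs0, if_false]
      split_ifs <;> linarith

/-- It is unlikely that the first `N` excursions contain less than half as many `k`-excursions as
expected. -/
lemma wordProb_returnsFrom_lt_le {k : ℕ} (hk : 1 ≤ k) (u N : ℕ) :
    wordProb u {w | N ≤ visits 0 w ∧ returnsFrom k 0 false w ≤ N / (8 * k)} ≤
      2 * Real.exp (-(N / (8 * k))) := by
  have hk' : (1 : ℝ) ≤ k := by exact_mod_cast hk
  have hk1 : 1 / (4 * (k : ℝ)) ≤ 1 / 4 := by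
    rw [div_le_div_iff₀ (by positivity) (by norm_num)]; linarith
  have hk0 : 0 < 1 / (4 * (k : ℝ)) := by positivity
  have hq : 0 < 1 - 1 / (4 * (k : ℝ)) := by linarith
  obtain ⟨ρ, hρ⟩ : ∃ ρ : ℝ, ρ = (1 - 1 / (4 * (k : ℝ)))⁻¹ := ⟨_, rfl⟩
  have hρ' : ρ * (1 - 1 / (4 * k)) = 1 := by rw [hρ, inv_mul_cancel₀ hq.ne']
  have hexp : Real.exp (1 / (4 * k)) ≤ ρ := by
    rw [hρ, ← neg_neg (1 / (4 * (k : ℝ))), Real.exp_neg, neg_neg]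
    gcongr
    have := Real.add_one_le_exp (-(1 / (4 * (k : ℝ)))); linarith
  have hmain := wordMean_returnsFrom_le hk hρ' u 0 false (by simp) (Or.inr (by omega))
  have h00 : returnPotential k ρ 0 false = 1 := by simp [returnPotential]
  rw [h00, mul_one] at hmain
  have hρ1 : 1 ≤ ρ := (Real.one_le_exp hk0.le).trans hexp
  have hρ0 : 0 ≤ ρ := by linarith
  -- Markov's inequality: on the event the weight is at least `exp(-N/(8k)) * exp(N/(4k))`.
  have hle := mul_wordProb_le (u := u)
    (A := {w | N ≤ visits 0 w ∧ returnsFrom k 0 false w ≤ N / (8 * k)})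
    (c := Real.exp (N / (8 * k)))
    (f := fun w => (1 / 2) ^ returnsFrom k 0 false w * ρ ^ visits 0 w)
    (fun w => by positivity) (by
      rintro w - ⟨h1, h2⟩
      have e1 : Real.exp (-(N / (8 * k))) ≤ (1 / 2) ^ returnsFrom k 0 false w := by
        calc Real.exp (-(N / (8 * k))) ≤ Real.exp (-(returnsFrom k 0 false w : ℝ)) := by
              gcongr
              have : ((N / (8 * k) : ℕ) : ℝ) ≤ (N : ℝ) / ((8 * k : ℕ) : ℝ) := Nat.cast_div_le
              push_cast at this
              exact le_trans (by exact_mod_cast h2) this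
          _ = Real.exp (-1) ^ returnsFrom k 0 false w := by
              rw [← Real.exp_nat_mul]; congr 1; ring
          _ ≤ _ := by
              gcongr
              rw [Real.exp_neg, one_div]
              gcongr
              have := Real.add_one_le_exp (1 : ℝ); linarith
      have e2 : Real.exp (N / (4 * k)) ≤ ρ ^ visits 0 w := by
        calc Real.exp (N / (4 * k)) = Real.exp (1 / (4 * k)) ^ N := by
              rw [← Real.exp_nat_mul]; congr 1; ring
          _ ≤ ρ ^ N := by gcongr
          _ ≤ _ := pow_le_pow_right₀ hρ1 h1
      calc Real.exp (N / (8 * k)) = Real.exp (-(N / (8 * k))) * Real.exp (N / (4 * k)) := by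
            rw [← Real.exp_add]; congr 1; field_simp; ring
        _ ≤ _ := by gcongr)
  rw [Real.exp_neg]
  rw [← div_eq_mul_inv, le_div_iff₀ (Real.exp_pos _)]
  linarith

/-! ### Many excursions for all depths at once -/

/-- The walk from `0` with steps `w` makes, for every `k` up to a small multiple of `N`, at least
of the order of `N / k` many `k`-excursions from `0`. -/
def ManyReturns (N : ℕ) (w : List Bool) : Prop :=
  ∀ k, 1 ≤ k → 2 ^ 14 * k ≤ N → N ≤ 16 * k * returnsFrom k 0 false w

/-- By monotonicity in `k` it suffices to treat powers of `2` up to `N/8192`, at the cost of a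
factor `2`. Too few visits contribute `1/192`; the dyadic depths contribute a geometric sum of at
most `1/256`. -/
lemma wordProb_not_manyReturns_le {N u : ℕ} (hN : 8192 ≤ N) (hu : 4 * (768 * N) ^ 2 ≤ u) :
    wordProb u {w | ¬ ManyReturns N w} ≤ 1 / 96 := by
  have hN' : (8192 : ℝ) ≤ N := by exact_mod_cast hN
  set J := Nat.log 2 (N / 8192) with hJ
  have hsub : ∀ w, w.length = u → w ∈ {w | ¬ ManyReturns N w} → w ∈ {w | visits 0 w < N} ∪
      ⋃ i ∈ Finset.range (J + 1),
        {w | N ≤ visits 0 w ∧ returnsFrom (2 ^ i) 0 false w ≤ N / (8 * 2 ^ i)} := by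
    intro w _ hw
    by_contra hcon
    apply hw
    intro k hk hkN
    simp only [Set.mem_union, Set.mem_ofPred_eq, Set.mem_iUnion, not_or, not_exists, not_and,
      not_lt, not_le, Finset.mem_range] at hcon
    have hi1 : k < 2 ^ (Nat.log 2 k + 1) := Nat.lt_pow_succ_log_self one_lt_two k
    have hi2 : 2 ^ (Nat.log 2 k) ≤ k := Nat.pow_log_le_self 2 (by omega)
    have hi3 : Nat.log 2 k + 1 ≤ J := by
      apply Nat.le_log_of_pow_le one_lt_two
      rw [Nat.le_div_iff_mul_le (by norm_num), pow_succ]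
      omega
    have h1 := hcon.2 (Nat.log 2 k + 1) (by omega) hcon.1
    have h2 := returnsFrom_anti hi1.le 0 false false id w
    rw [Nat.div_lt_iff_lt_mul (by positivity)] at h1
    calc N ≤ returnsFrom (2 ^ (Nat.log 2 k + 1)) 0 false w * (8 * 2 ^ (Nat.log 2 k + 1)) := h1.le
      _ ≤ returnsFrom k 0 false w * (8 * 2 ^ (Nat.log 2 k + 1)) := by gcongr
      _ = returnsFrom k 0 false w * (16 * 2 ^ (Nat.log 2 k)) := by rw [pow_succ]; ring
      _ ≤ returnsFrom k 0 false w * (16 * k) := by gcongr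
      _ = _ := by ring
  have hvis : wordProb u {w | visits 0 w < N} ≤ 1 / 192 := by
    refine (wordProb_visits_lt_le (h := 768 * N) (by omega) hu N).trans_eq ?_
    push_cast; field_simp; norm_num
  have hpow : (2 : ℝ) ^ J ≤ N / 8192 := by
    have h1 : 2 ^ J ≤ N / 8192 := Nat.pow_log_le_self 2 (by omega)
    have h2 : ((N / 8192 : ℕ) : ℝ) ≤ (N : ℝ) / ((8192 : ℕ) : ℝ) := Nat.cast_div_le
    calc (2 : ℝ) ^ J = ((2 ^ J : ℕ) : ℝ) := by push_cast; rfl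
      _ ≤ ((N / 8192 : ℕ) : ℝ) := by exact_mod_cast h1
      _ ≤ _ := by exact_mod_cast h2
  have hterm : ∀ i : ℕ, wordProb u
      {w | N ≤ visits 0 w ∧ returnsFrom (2 ^ i) 0 false w ≤ N / (8 * 2 ^ i)} ≤
      16 / N * 2 ^ i := by
    intro i
    refine (wordProb_returnsFrom_lt_le Nat.one_le_two_pow u N).trans ?_
    push_cast
    have hy : (0 : ℝ) < N / (8 * 2 ^ i) := by positivity
    have := Real.add_one_le_exp ((N : ℝ) / (8 * 2 ^ i))
    calc 2 * Real.exp (-(N / (8 * 2 ^ i))) ≤ 2 * ((N : ℝ) / (8 * 2 ^ i))⁻¹ := by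
          rw [Real.exp_neg]; gcongr; linarith
      _ = _ := by field_simp; norm_num
  have hsum : ∑ i ∈ Finset.range (J + 1), wordProb u
      {w | N ≤ visits 0 w ∧ returnsFrom (2 ^ i) 0 false w ≤ N / (8 * 2 ^ i)} ≤ 1 / 256 := by
    refine (Finset.sum_le_sum fun i _ => hterm i).trans ?_
    rw [← Finset.mul_sum, geom_sum_eq (by norm_num), pow_succ]
    calc 16 / (N : ℝ) * ((2 ^ J * 2 - 1) / (2 - 1)) ≤ 16 / (N : ℝ) * (N / 8192 * 2) := by
          gcongr; linarith
      _ = _ := by field_simp; norm_num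
  have h1 := wordProb_mono hsub
  have h2 := wordProb_union_le u {w | visits 0 w < N} (⋃ i ∈ Finset.range (J + 1),
        {w | N ≤ visits 0 w ∧ returnsFrom (2 ^ i) 0 false w ≤ N / (8 * 2 ^ i)})
  have h3 := wordProb_biUnion_le u (Finset.range (J + 1))
    fun i => {w | N ≤ visits 0 w ∧ returnsFrom (2 ^ i) 0 false w ≤ N / (8 * 2 ^ i)}
  linarith

/-! ### Climbing blocks -/

/-- The walk from `s` with steps `w` hits `0` by time `d`, and makes few excursions after that. -/
def FewReturnsAfterHit (N : ℕ) : ℕ → ℤ → List Bool → Prop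
  | 0, s, w => s = 0 ∧ ¬ ManyReturns N w
  | d + 1, s, w => if s = 0 then ¬ ManyReturns N w else
    match w with
    | [] => False
    | b :: w => FewReturnsAfterHit N d (s + stepValue b) w

/-- Strong Markov property at the hitting time of `0`: at least `u` fresh letters remain whenever
the hit occurs. -/
lemma wordProb_fewReturnsAfterHit_le {N u : ℕ} (hN : 8192 ≤ N) (hu : 4 * (768 * N) ^ 2 ≤ u)
    (d : ℕ) (s : ℤ) : wordProb (d + u) {w | FewReturnsAfterHit N d s w} ≤ 1 / 96 := by
  induction d generalizing s with
  | zero =>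
    refine (wordProb_mono fun w _ hw => ?_).trans
      (wordProb_not_manyReturns_le hN (hu.trans (Nat.le_add_left _ _)))
    exact hw.2
  | succ d ih =>
    by_cases hs : s = 0
    · simp only [FewReturnsAfterHit, hs, if_true]
      exact wordProb_not_manyReturns_le hN (hu.trans (Nat.le_add_left _ _))
    · rw [Nat.succ_add, wordProb_succ]
      simp only [FewReturnsAfterHit, hs, if_false, Set.mem_ofPred_eq]
      have h1 := ih (s + stepValue true)
      have h2 := ih (s + stepValue false)
      linarith

/-- Discrete intermediate value property: unit steps from `s ≤ 0` to a nonnegative position pass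
through `0`. -/
lemma exists_hit_manyReturns {N d : ℕ} {s : ℤ} {w : List Bool}
    (h : ¬ FewReturnsAfterHit N d s w) (hs : s ≤ 0) (hd : 0 ≤ s + displacement (w.take d)) :
    ∃ i ≤ d, i ≤ w.length ∧ s + displacement (w.take i) = 0 ∧ ManyReturns N (w.drop i) := by
  induction d generalizing s w with
  | zero =>
    have hs0 : s = 0 := by simp at hd; omega
    exact ⟨0, le_rfl, Nat.zero_le _, by simp [hs0], by
      simpa [FewReturnsAfterHit, hs0] using h⟩
  | succ d ih =>
    by_cases hs0 : s = 0
    · exact ⟨0, Nat.zero_le _, Nat.zero_le _, by simp [hs0], by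
        simpa [FewReturnsAfterHit, hs0] using h⟩
    · cases w with
      | nil => simp at hd; omega
      | cons b w =>
        simp only [FewReturnsAfterHit, hs0, if_false] at h
        obtain ⟨i, hi, hi', h1, h2⟩ := ih h (by cases b <;> simp <;> omega)
          (by simp at hd; omega)
        exact ⟨i + 1, by omega, by simpa using hi', by simp; omega, by simpa using h2⟩

/-- The number of steps in a block of the construction with parameter `N`. -/
def blockLength (N : ℕ) : ℕ := 4 * (768 * N) ^ 2 + 4 * (768 * N) ^ 2

/-- The walk with steps `w` rises by `768 * N`, and at least half of the points on its way up are
starting points of many excursions. -/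
def climbingBlock (N : ℕ) : Set (List Bool) :=
  {w | ((768 * N : ℕ) : ℤ) ≤ displacement (w.take (4 * (768 * N) ^ 2)) ∧
    0 ≤ displacement (w.drop (4 * (768 * N) ^ 2)) ∧
    2 * Set.ncard {x : ℕ | x ∈ Finset.Icc 1 (768 * N) ∧
      FewReturnsAfterHit N (4 * (768 * N) ^ 2) (-(x : ℤ)) w} ≤ 768 * N}

/-- Rising in the first half and not falling in the second has probability at least `1/12 * 1/2`.
The second half leaves each level hit in the first enough time for its excursions, so the mean
number of bad levels is at most `h/96`, and by Markov more than `h/2` are bad with probability at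
most `1/48`. -/
lemma wordProb_climbingBlock_ge {N : ℕ} (hN : 8192 ≤ N) :
    1 / 48 ≤ wordProb (blockLength N) (climbingBlock N) := by
  classical
  set h := 768 * N with hh
  have hh0 : 0 < h := by omega
  have hh' : (0 : ℝ) < h := by exact_mod_cast hh0
  have h1 := wordProb_take_drop (4 * h ^ 2) (4 * h ^ 2) {w | (h : ℤ) ≤ displacement w}
    {w | 0 ≤ displacement w}
  have h2 := one_twelfth_le_wordProb hh0
  have h3 := one_half_le_wordProb (4 * h ^ 2)
  set bad : Set (List Bool) := {w | h < 2 * Set.ncard {x : ℕ | x ∈ Finset.Icc 1 h ∧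
      FewReturnsAfterHit N (4 * h ^ 2) (-(x : ℤ)) w}} with hbad
  have h4 : (h : ℝ) * wordProb (blockLength N) bad ≤ h * (1 / 48) := by
    refine (mul_wordProb_le (f := fun w => 2 * ∑ x ∈ Finset.Icc 1 h,
      ({w | FewReturnsAfterHit N (4 * h ^ 2) (-(x : ℤ)) w} : Set (List Bool)).indicator 1 w)
      (fun w => ?_) ?_).trans ?_
    · exact mul_nonneg zero_le_two (Finset.sum_nonneg fun x _ =>
        Set.indicator_nonneg (fun _ _ => zero_le_one) w)
    · intro w _ hw
      have e : {x : ℕ | x ∈ Finset.Icc 1 h ∧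
          FewReturnsAfterHit N (4 * h ^ 2) (-(x : ℤ)) w} =
          (((Finset.Icc 1 h).filter fun x : ℕ =>
            FewReturnsAfterHit N (4 * h ^ 2) (-(x : ℤ)) w : Finset ℕ) : Set ℕ) := by
        ext; simp
      simp only [hbad, Set.mem_ofPred_eq] at hw
      rw [e, Set.ncard_coe_finset] at hw
      simp only [Set.indicator_apply, Set.mem_ofPred_eq, Pi.one_apply, Finset.sum_boole]
      exact_mod_cast hw.le
    · rw [wordMean_const_mul, wordMean_sum]
      have : ∀ x ∈ Finset.Icc 1 h, wordMean (blockLength N)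
          (({w | FewReturnsAfterHit N (4 * h ^ 2) (-(x : ℤ)) w} : Set (List Bool)).indicator 1) ≤
            1 / 96 := fun x _ => wordProb_fewReturnsAfterHit_le hN le_rfl (4 * h ^ 2) (-(x : ℤ))
      have := Finset.sum_le_sum this
      simp only [Finset.sum_const, Nat.card_Icc, add_tsub_cancel_right, nsmul_eq_mul] at this
      linarith
  have h5 := le_of_mul_le_mul_left h4 hh'
  have h6 := (wordProb_mono (u := blockLength N) (A := {w | w.take (4 * h ^ 2) ∈
    {w | (h : ℤ) ≤ displacement w} ∧ w.drop (4 * h ^ 2) ∈ {w | 0 ≤ displacement w}})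
    (B := climbingBlock N ∪ bad) (by
      rintro w - ⟨ha, hb⟩
      by_cases hw : w ∈ bad
      · exact Or.inr hw
      · exact Or.inl ⟨ha, hb, not_lt.mp hw⟩)).trans (wordProb_union_le _ _ _)
  change wordProb (blockLength N) _ = _ at h1
  rw [h1] at h6
  have h7 : (1 / 12 : ℝ) * (1 / 2) ≤ _ := mul_le_mul h2 h3 (by norm_num) (wordProb_nonneg _ _)
  linarith

/-- Words that start with `q` climbing blocks. -/
def climbingBlocks (N : ℕ) : ℕ → Set (List Bool)
  | 0 => Set.univ
  | q + 1 => {w | w.take (blockLength N) ∈ climbingBlock N ∧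
      w.drop (blockLength N) ∈ climbingBlocks N q}

lemma wordProb_climbingBlocks_ge {N : ℕ} (hN : 8192 ≤ N) (q : ℕ) :
    (1 / 48) ^ q ≤ wordProb (q * blockLength N) (climbingBlocks N q) := by
  induction q with
  | zero => simp [climbingBlocks, wordProb_univ]
  | succ q ih =>
    rw [Nat.succ_mul, add_comm (q * _)]
    refine le_of_le_of_eq ?_ (wordProb_take_drop _ _ (climbingBlock N) (climbingBlocks N q)).symm
    rw [pow_succ']
    exact mul_le_mul (wordProb_climbingBlock_ge hN) ih (by positivity) (wordProb_nonneg _ _)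

/-! ### From words to trajectories -/

/-- The word of the up and down steps that the trajectory `s` makes in the `u` steps after
time `t`. -/
def stepWord (s : ℕ → ℤ) : ℕ → ℕ → List Bool
  | _, 0 => []
  | t, u + 1 => decide (s (t + 1) - s t = 1) :: stepWord s (t + 1) u

@[simp] lemma length_stepWord (s : ℕ → ℤ) (t u : ℕ) : (stepWord s t u).length = u := by
  induction u generalizing t with
  | zero => rfl
  | succ u ih => simp [stepWord, ih]

lemma take_stepWord (s : ℕ → ℤ) (t i v : ℕ) :
    (stepWord s t (i + v)).take i = stepWord s t i := by
  induction i generalizing t with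
  | zero => simp [stepWord]
  | succ i ih => rw [Nat.succ_add]; simp [stepWord, ih]

lemma drop_stepWord (s : ℕ → ℤ) (t i v : ℕ) :
    (stepWord s t (i + v)).drop i = stepWord s (t + i) v := by
  induction i generalizing t with
  | zero => simp
  | succ i ih =>
    rw [Nat.succ_add]
    simp only [stepWord, List.drop_succ_cons, ih]
    congr 1; omega

lemma stepValue_decide {s : ℕ → ℤ} (hs : ∀ t, s (t + 1) - s t = 1 ∨ s (t + 1) - s t = -1)
    (t : ℕ) : stepValue (decide (s (t + 1) - s t = 1)) = s (t + 1) - s t := by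
  rcases hs t with h | h <;> simp [h]

lemma displacement_stepWord {s : ℕ → ℤ} (hs : ∀ t, s (t + 1) - s t = 1 ∨ s (t + 1) - s t = -1)
    (t u : ℕ) : displacement (stepWord s t u) = s (t + u) - s t := by
  induction u generalizing t with
  | zero => simp [stepWord]
  | succ u ih =>
    rw [stepWord, displacement_cons, stepValue_decide hs, ih,
      show t + 1 + u = t + (u + 1) by omega]
    ring

lemma finite_excursionStarts (s : ℕ → ℤ) (k n : ℕ) (p : ℕ → Prop) :
    {j : ℕ | p j ∧ ∃ m, m ≤ n ∧ IsExcursion s k j m}.Finite :=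
  (Set.finite_Iio n).subset fun _ ⟨_, _, hm, h⟩ => lt_of_lt_of_le h.1 hm

/-- Here `j₀` is the last visit to `x` up to time `t`, the start of the running excursion, and `f`
records whether that excursion has already reached `x - k`. -/
lemma returnsFrom_le_ncard {s : ℕ → ℤ} (hs : ∀ t, s (t + 1) - s t = 1 ∨ s (t + 1) - s t = -1)
    {k : ℕ} (hk : 1 ≤ k) {x : ℤ} (u t j₀ : ℕ) (f : Bool) (hj : j₀ ≤ t) (hx : s j₀ = x)
    (hfirst : ∀ i, j₀ < i → i ≤ t → s i ≠ x)
    (hf : f = true → ∃ i, j₀ < i ∧ i ≤ t ∧ s i = x - k) (hf' : f = true ∨ x - k < s t) :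
    returnsFrom k (s t - x) f (stepWord s t u) ≤
      Set.ncard {j | (j₀ ≤ j ∧ s j = x) ∧ ∃ m, m ≤ t + u ∧ IsExcursion s k j m} := by
  induction u generalizing t j₀ f with
  | zero => simp [stepWord, returnsFrom]
  | succ u ih =>
    rw [stepWord, returnsFrom, stepValue_decide hs, show s t - x + (s (t + 1) - s t) =
      s (t + 1) - x by ring, show t + (u + 1) = t + 1 + u by omega]
    have hfin := finite_excursionStarts s k (t + 1 + u) (fun j => j₀ ≤ j ∧ s j = x)
    split_ifs with h hft
    · have h0 : s (t + 1) = x := by omega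
      obtain ⟨i, hi1, hi2, hi3⟩ := hf hft
      have := ih (t + 1) (t + 1) false le_rfl h0 (fun i _ _ => by omega) (by simp)
        (Or.inr (by omega))
      rw [h] at this
      have hmem : j₀ ∈ {j | (j₀ ≤ j ∧ s j = x) ∧ ∃ m, m ≤ t + 1 + u ∧ IsExcursion s k j m} :=
        ⟨⟨le_rfl, hx⟩, t + 1, by omega, by omega, by rw [h0, hx],
          fun i h1 h2 => by rw [hx]; exact hfirst i h1 (by omega), i, hi1, by omega,
          by rw [hi3, hx]⟩
      rw [add_comm]
      refine le_trans (Nat.add_le_add_right this 1) ?_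
      have hnot : j₀ ∉ {j | (t + 1 ≤ j ∧ s j = x) ∧ ∃ m, m ≤ t + 1 + u ∧ IsExcursion s k j m} :=
        fun hh => by have := hh.1.1; omega
      rw [← Set.ncard_insert_of_notMem hnot (finite_excursionStarts _ _ _ _)]
      refine Set.ncard_le_ncard (Set.insert_subset hmem ?_) hfin
      rintro j ⟨⟨h1, h2⟩, h3⟩
      exact ⟨⟨by omega, h2⟩, h3⟩
    · have h0 : s (t + 1) = x := by omega
      have := ih (t + 1) (t + 1) false le_rfl h0 (fun i _ _ => by omega) (by simp)
        (Or.inr (by omega))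
      rw [h] at this
      rw [zero_add]
      refine this.trans (Set.ncard_le_ncard ?_ hfin)
      rintro j ⟨⟨h1, h2⟩, h3⟩
      exact ⟨⟨by omega, h2⟩, h3⟩
    · refine ih (t + 1) j₀ _ (by omega) hx ?_ ?_ ?_
      · intro i h1 h2
        rcases Nat.lt_or_ge i (t + 1) with h3 | h3
        · exact hfirst i h1 (by omega)
        · rw [le_antisymm h2 h3]; omega
      · simp only [Bool.or_eq_true, decide_eq_true_eq]
        intro hor
        by_cases hft : f = true
        · obtain ⟨i, h1, h2, h3⟩ := hf hft
          exact ⟨i, h1, by omega, h3⟩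
        · have h1 := hor.resolve_left hft
          have h2 := hf'.resolve_left hft
          -- The walk was above `x - k` and moves by unit steps, so it meets that level exactly.
          refine ⟨t + 1, by omega, le_rfl, ?_⟩
          rcases hs t with h3 | h3 <;> omega
      · simp only [Bool.or_eq_true, decide_eq_true_eq]
        by_cases h1 : s (t + 1) - x ≤ -k
        · exact Or.inl (Or.inr h1)
        · right; omega

lemma returnsFrom_le_excursionCount {s : ℕ → ℤ}
    (hs : ∀ t, s (t + 1) - s t = 1 ∨ s (t + 1) - s t = -1) {k : ℕ} (hk : 1 ≤ k) {t u n : ℕ}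
    (hn : t + u ≤ n) :
    returnsFrom k 0 false (stepWord s t u) ≤ excursionCount s k (s t) n := by
  have := returnsFrom_le_ncard hs hk u t t false le_rfl rfl (fun i _ _ => by omega) (by simp)
    (Or.inr (by omega))
  rw [sub_self] at this
  refine this.trans (Set.ncard_le_ncard ?_ (finite_excursionStarts s k n fun j => s j = s t))
  rintro j ⟨⟨_, h2⟩, m, h3, h4⟩
  exact ⟨h2, m, by omega, h4⟩

/-- The point `x` is the starting point of at least of the order of `N / k` many `k`-excursions,
for every `k` up to a small multiple of `N`. -/
def IsRichPoint (s : ℕ → ℤ) (N n : ℕ) (x : ℤ) : Prop :=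
  ∀ k, 1 ≤ k → 2 ^ 14 * k ≤ N → N ≤ 16 * k * excursionCount s k x n

lemma exists_richPoints_of_climbingBlock {s : ℕ → ℤ}
    (hs : ∀ t, s (t + 1) - s t = 1 ∨ s (t + 1) - s t = -1) {N t n : ℕ}
    (hn : t + blockLength N ≤ n) (hw : stepWord s t (blockLength N) ∈ climbingBlock N) :
    s t + (768 * N : ℕ) ≤ s (t + blockLength N) ∧ ∃ X : Finset ℤ,
      (∀ x ∈ X, s t < x ∧ x ≤ s t + (768 * N : ℕ)) ∧ 768 * N ≤ 2 * X.card ∧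
      ∀ x ∈ X, IsRichPoint s N n x := by
  classical
  obtain ⟨h1, h2, h3⟩ := hw
  rw [blockLength, take_stepWord, displacement_stepWord hs] at h1
  rw [blockLength, drop_stepWord, displacement_stepWord hs, add_assoc, ← blockLength] at h2
  refine ⟨by omega, ?_⟩
  set h := 768 * N with hh
  set w := stepWord s t (blockLength N) with hw
  set bad := (Finset.Icc 1 h).filter fun x : ℕ => FewReturnsAfterHit N (4 * h ^ 2) (-(x : ℤ)) w
    with hbad
  have e : {x : ℕ | x ∈ Finset.Icc 1 h ∧ FewReturnsAfterHit N (4 * h ^ 2) (-(x : ℤ)) w} =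
      (bad : Set ℕ) := by
    ext; simp [hbad]
  rw [e, Set.ncard_coe_finset] at h3
  have hcard := Finset.card_sdiff_add_card_eq_card (Finset.filter_subset
    (fun x : ℕ => FewReturnsAfterHit N (4 * h ^ 2) (-(x : ℤ)) w) (Finset.Icc 1 h))
  rw [← hbad, Nat.card_Icc] at hcard
  refine ⟨(Finset.Icc 1 h \ bad).image fun x : ℕ => s t + x, ?_, ?_, ?_⟩
  · intro y hy
    obtain ⟨x, hx, rfl⟩ := Finset.mem_image.mp hy
    have := Finset.mem_Icc.mp (Finset.mem_sdiff.mp hx).1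
    omega
  · rw [Finset.card_image_of_injective _ (fun a b hab => by simpa using hab)]
    omega
  · intro y hy
    obtain ⟨x, hx, rfl⟩ := Finset.mem_image.mp hy
    have hx' := Finset.mem_sdiff.mp hx
    have hxI := Finset.mem_Icc.mp hx'.1
    have hgood : ¬ FewReturnsAfterHit N (4 * h ^ 2) (-(x : ℤ)) w := fun hcon =>
      hx'.2 (Finset.mem_filter.mpr ⟨hx'.1, hcon⟩)
    have htake : w.take (4 * h ^ 2) = stepWord s t (4 * h ^ 2) := take_stepWord _ _ _ _
    obtain ⟨i, -, hi, hi1, hi2⟩ := exists_hit_manyReturns hgood (by omega) (by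
      rw [htake, displacement_stepWord hs]; omega)
    rw [hw, length_stepWord] at hi
    obtain ⟨v, hv⟩ := Nat.exists_eq_add_of_le hi
    rw [hw, hv, take_stepWord, displacement_stepWord hs] at hi1
    rw [hw, hv, drop_stepWord] at hi2
    intro k hk hkN
    have h4 := returnsFrom_le_excursionCount hs hk (t := t + i) (u := v) (n := n) (by omega)
    rw [show s (t + i) = s t + x by omega] at h4
    exact (hi2 k hk hkN).trans (Nat.mul_le_mul_left _ h4)

/-- Each block ends at or above all the rich points found in it, so different blocks give disjoint
sets of points. -/
lemma exists_richPoints_of_climbingBlocks {s : ℕ → ℤ}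
    (hs : ∀ t, s (t + 1) - s t = 1 ∨ s (t + 1) - s t = -1) {N n q t : ℕ}
    (hn : t + q * blockLength N ≤ n)
    (hw : stepWord s t (q * blockLength N) ∈ climbingBlocks N q) :
    ∃ X : Finset ℤ, (∀ x ∈ X, s t < x) ∧ q * (768 * N) ≤ 2 * X.card ∧
      ∀ x ∈ X, IsRichPoint s N n x := by
  classical
  induction q generalizing t with
  | zero => exact ⟨∅, by simp, by simp, by simp⟩
  | succ q ih =>
    rw [Nat.succ_mul, add_comm (q * _)] at hn hw
    obtain ⟨h1, h2⟩ := hw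
    rw [take_stepWord] at h1
    rw [drop_stepWord] at h2
    obtain ⟨hclimb, X, hX1, hX2, hX3⟩ := exists_richPoints_of_climbingBlock hs (n := n)
      (by omega) h1
    obtain ⟨Y, hY1, hY2, hY3⟩ := ih (by omega) h2
    refine ⟨X ∪ Y, ?_, ?_, ?_⟩
    · intro x hx
      rcases Finset.mem_union.mp hx with hx | hx
      · exact (hX1 x hx).1
      · have := hY1 x hx; omega
    · rw [Finset.card_union_of_disjoint, Nat.succ_mul]
      · omega
      · rw [Finset.disjoint_left]
        intro x hx hy
        have h3 := hX1 x hx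
        have h4 := hY1 x hy
        omega
    · intro x hx
      rcases Finset.mem_union.mp hx with hx | hx
      · exact hX3 x hx
      · exact hY3 x hx

lemma excursionCount_eq_zero {s : ℕ → ℤ} {k n : ℕ} {x : ℤ}
    (hx : x ∉ (Finset.range n).image s) : excursionCount s k x n = 0 := by
  rw [excursionCount]
  convert Set.ncard_empty ℕ
  ext j
  simp only [Set.mem_ofPred_eq, Set.mem_empty_iff_false, iff_false]
  rintro ⟨h1, m, h2, h3⟩
  exact hx (Finset.mem_image.mpr ⟨j, Finset.mem_range.mpr (lt_of_lt_of_le h3.1 h2), h1⟩)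

lemma card_mul_min_le_truncatedSum {s : ℕ → ℤ} {k n N : ℕ} {l : ℝ} (hl : 0 ≤ l) (hk : 1 ≤ k)
    (hkN : 2 ^ 14 * k ≤ N) {X : Finset ℤ} (hX : ∀ x ∈ X, IsRichPoint s N n x) :
    X.card * min ((N : ℝ) / (16 * k)) l ≤ truncatedSum s k n l := by
  -- Without summability the `tsum` would take its default value `0`; `hl` makes the terms vanish at
  -- unvisited points.
  have hsum : Summable fun x : ℤ => min (excursionCount s k x n : ℝ) l :=
    summable_of_ne_finset_zero (s := (Finset.range n).image s) fun x hx => by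
      rw [excursionCount_eq_zero hx]; simpa using hl
  refine le_trans ?_ (hsum.sum_le_tsum X fun x _ => le_min (Nat.cast_nonneg _) hl)
  rw [← nsmul_eq_mul]
  refine Finset.card_nsmul_le_sum _ _ _ fun x hx => ?_
  gcongr
  have h1 := hX x hx k hk hkN
  have hk' : (0 : ℝ) < k := by exact_mod_cast hk
  rw [div_le_iff₀ (by positivity)]
  have : (N : ℝ) ≤ 16 * k * excursionCount s k x n := by exact_mod_cast h1
  linarith

/-! ### Independence and the law of the step words -/

lemma iIndepSet_of_measurableSet_iSup {Ω ι κ : Type*} {mΩ : MeasurableSpace Ω} {P : Measure Ω}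
    [IsProbabilityMeasure P] {m : κ → MeasurableSpace Ω} (hm : ∀ i, m i ≤ mΩ)
    (hind : iIndep m P) (I : ι → Set κ) (hI : Pairwise fun a b => Disjoint (I a) (I b))
    {E : ι → Set Ω} (hE : ∀ a, MeasurableSet[⨆ i ∈ I a, m i] (E a)) : iIndepSet E P := by
  classical
  have hE' : ∀ a, MeasurableSet (E a) := fun a => iSup₂_le (fun i _ => hm i) _ (hE a)
  rw [iIndepSet_iff_meas_biInter hE']
  intro s
  induction s using Finset.induction_on with
  | empty => simp
  | insert a s ha ih =>
    rw [Finset.set_biInter_insert, Finset.prod_insert ha, ← ih]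
    have hdisj : Disjoint (I a) (⋃ b ∈ s, I b) := by
      simp only [Set.disjoint_iUnion_right]
      exact fun b hb => hI fun h => ha (h ▸ hb)
    refine (Indep_iff _ _ _).1 (indep_iSup_of_disjoint hm hind hdisj) _ _ (hE a) ?_
    refine Finset.measurableSet_biInter s fun b hb => ?_
    exact (iSup₂_mono' fun i hi => ⟨i, Set.mem_biUnion hb hi, le_rfl⟩ :
      ⨆ i ∈ I b, m i ≤ ⨆ i ∈ ⋃ b ∈ s, I b, m i) _ (hE b)

/-- The σ-algebra generated by the step of the walk after time `t`. -/
abbrev stepSigma {Ω : Type*} (S : ℕ → Ω → ℤ) (t : ℕ) : MeasurableSpace Ω :=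
  MeasurableSpace.comap (fun ω => S (t + 1) ω - S t ω) ⊤

lemma setOf_stepWord_succ {Ω : Type*} {S : ℕ → Ω → ℤ} (t u : ℕ) (A : Set (List Bool)) :
    {ω | stepWord (fun t => S t ω) t (u + 1) ∈ A} =
      ({ω | S (t + 1) ω - S t ω = 1} ∩
        {ω | stepWord (fun t => S t ω) (t + 1) u ∈ {w | true :: w ∈ A}}) ∪
      ({ω | S (t + 1) ω - S t ω = 1}ᶜ ∩
        {ω | stepWord (fun t => S t ω) (t + 1) u ∈ {w | false :: w ∈ A}}) := by
  ext ω
  by_cases h : S (t + 1) ω - S t ω = 1 <;> simp [stepWord, h]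

lemma measurableSet_stepSigma {Ω : Type*} {S : ℕ → Ω → ℤ} (t : ℕ) (d : ℤ) :
    MeasurableSet[stepSigma S t] {ω | S (t + 1) ω - S t ω = d} :=
  ⟨{d}, trivial, rfl⟩

lemma measurableSet_stepWord {Ω : Type*} {S : ℕ → Ω → ℤ} (t u : ℕ) (A : Set (List Bool)) :
    MeasurableSet[⨆ i ∈ Set.Ico t (t + u), stepSigma S i]
      {ω | stepWord (fun t => S t ω) t u ∈ A} := by
  induction u generalizing t A with
  | zero => exact @MeasurableSet.const Ω (⨆ i ∈ Set.Ico t (t + 0), stepSigma S i) ([] ∈ A)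
  | succ u ih =>
    have h1 : stepSigma S t ≤ ⨆ i ∈ Set.Ico t (t + (u + 1)), stepSigma S i :=
      le_iSup₂_of_le t (by simp) le_rfl
    have h2 : ⨆ i ∈ Set.Ico (t + 1) (t + 1 + u), stepSigma S i ≤
        ⨆ i ∈ Set.Ico t (t + (u + 1)), stepSigma S i :=
      iSup₂_mono' fun i hi => ⟨i, by simp only [Set.mem_Ico] at hi ⊢; omega, le_rfl⟩
    rw [setOf_stepWord_succ]
    have h3 := h1 _ (measurableSet_stepSigma t 1)
    exact (h3.inter (h2 _ (ih _ _))).union (h3.compl.inter (h2 _ (ih _ _)))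

lemma stepSigma_le {Ω : Type*} [mΩ : MeasurableSpace Ω] {P : Measure Ω} {S : ℕ → Ω → ℤ}
    (hS : IsSimpleRandomWalk P S) (t : ℕ) : stepSigma S t ≤ mΩ :=
  Measurable.comap_le ((hS.measurable (t + 1)).sub (hS.measurable t))

lemma iIndep_stepSigma {Ω : Type*} [mΩ : MeasurableSpace Ω] {P : Measure Ω} {S : ℕ → Ω → ℤ}
    (hS : IsSimpleRandomWalk P S) : iIndep (stepSigma S) P :=
  hS.indep.iIndep

lemma ae_forall_step {Ω : Type*} [mΩ : MeasurableSpace Ω] {P : Measure Ω} {S : ℕ → Ω → ℤ}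
    (hS : IsSimpleRandomWalk P S) [IsProbabilityMeasure P] :
    ∀ᵐ ω ∂P, ∀ t, S (t + 1) ω - S t ω = 1 ∨ S (t + 1) ω - S t ω = -1 := by
  rw [ae_all_iff]
  intro t
  have h1 := stepSigma_le hS t _ (measurableSet_stepSigma t 1)
  have h2 := stepSigma_le hS t _ (measurableSet_stepSigma t (-1))
  have h3 : {ω | S (t + 1) ω - S t ω = 1 ∨ S (t + 1) ω - S t ω = -1} =
      {ω | S (t + 1) ω - S t ω = 1} ∪ {ω | S (t + 1) ω - S t ω = -1} := rfl
  change {ω | S (t + 1) ω - S t ω = 1 ∨ S (t + 1) ω - S t ω = -1} ∈ ae P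
  rw [mem_ae_iff_prob_eq_one (h3 ▸ h1.union h2), h3, measure_union _ h2, hS.step_up,
    hS.step_down, ENNReal.add_halves]
  rw [Set.disjoint_left]
  intro ω h4 h5
  simp only [Set.mem_ofPred_eq] at h4 h5
  omega

/-- The first step is independent of the later ones, so the law of the word satisfies the recursion
defining `wordMean`. -/
lemma measureReal_stepWord {Ω : Type*} [mΩ : MeasurableSpace Ω] {P : Measure Ω} {S : ℕ → Ω → ℤ}
    (hS : IsSimpleRandomWalk P S) [IsProbabilityMeasure P] (t u : ℕ)
    (A : Set (List Bool)) :
    P.real {ω | stepWord (fun t => S t ω) t u ∈ A} = wordProb u A := by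
  induction u generalizing t A with
  | zero =>
    by_cases h : [] ∈ A <;> simp [stepWord, wordProb_zero, h]
  | succ u ih =>
    have hB := measurableSet_stepSigma (S := S) t 1
    have hB' := stepSigma_le hS t _ hB
    have hind := (Indep_iff _ _ _).1 (indep_iSup_of_disjoint (S := {t})
      (T := Set.Ico (t + 1) (t + 1 + u)) (stepSigma_le hS) (iIndep_stepSigma hS) (by simp))
    have hmul : ∀ B, MeasurableSet[stepSigma S t] B → ∀ A,
        P.real (B ∩ {ω | stepWord (fun t => S t ω) (t + 1) u ∈ A}) =
          P.real B * wordProb u A := by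
      intro B hB A
      rw [← ih (t + 1), measureReal_def, hind _ _ ((le_iSup₂_of_le t rfl le_rfl :
        stepSigma S t ≤ ⨆ i ∈ ({t} : Set ℕ), stepSigma S i) _ hB)
        (measurableSet_stepWord (t + 1) u A), ENNReal.toReal_mul]
      rfl
    have hhalf : P.real {ω | S (t + 1) ω - S t ω = 1} = 1 / 2 := by
      rw [measureReal_def, hS.step_up]; simp
    have hA : ∀ A, MeasurableSet {ω | stepWord (fun t => S t ω) (t + 1) u ∈ A} := fun A =>
      (iSup₂_le fun i _ => stepSigma_le hS i) _ (measurableSet_stepWord (t + 1) u A)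
    rw [setOf_stepWord_succ, measureReal_union _ (hB'.compl.inter (hA _)), hmul _ hB,
      hmul _ hB.compl, probReal_compl_eq_one_sub hB', hhalf, wordProb_succ]
    · ring
    · exact Set.disjoint_left.mpr fun ω h1 h2 => h2.1 h1.1

/-! ### Dyadic stages and Borel–Cantelli -/

/-- The number of climbing blocks in the `j`-th stage, which covers the times from `2 ^ j` to
`2 ^ (j + 1)`. -/
def stageBlocks (j : ℕ) : ℕ := Nat.log 48 j

/-- The parameter of the climbing blocks in the `j`-th stage. -/
def stageScale (j : ℕ) : ℕ := Nat.sqrt (2 ^ j / (4718592 * stageBlocks j))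

lemma stage_length_le (j : ℕ) : stageBlocks j * blockLength (stageScale j) ≤ 2 ^ j := by
  have h1 : stageScale j * stageScale j ≤ 2 ^ j / (4718592 * stageBlocks j) := Nat.sqrt_le _
  -- `4718592 = 8 * 768 ^ 2`, so a block has `4718592 * N ^ 2` steps.
  calc stageBlocks j * blockLength (stageScale j)
      = 4718592 * stageBlocks j * (stageScale j * stageScale j) := by rw [blockLength]; ring
    _ ≤ 4718592 * stageBlocks j * (2 ^ j / (4718592 * stageBlocks j)) := by gcongr
    _ ≤ 2 ^ j := Nat.mul_div_le _ _

lemma stageBlocks_pos {j : ℕ} (hj : 64 ≤ j) : 1 ≤ stageBlocks j :=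
  Nat.le_log_of_pow_le (by norm_num) (by omega)

lemma stageScale_ge {j : ℕ} (hj : 64 ≤ j) : 8192 ≤ stageScale j := by
  -- `4718592 * 8192 ^ 2 < 2 ^ 49`.
  have h1 : 2 ^ 49 * j ≤ 2 ^ j := by
    induction j, hj using Nat.le_induction with
    | base => norm_num
    | succ j hj ih => rw [pow_succ]; omega
  have h2 : stageBlocks j ≤ j := Nat.log_le_self 48 j
  rw [stageScale, Nat.le_sqrt, Nat.le_div_iff_mul_le (by have := stageBlocks_pos hj; omega)]
  omega

/-- The rounding in the square root costs `(N + 1)² ≤ 4N²`, whence `37748736 = 2 * 4 * 4718592`. -/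
lemma two_pow_succ_le {j : ℕ} (hj : 64 ≤ j) :
    2 ^ (j + 1) ≤ 37748736 * stageBlocks j * stageScale j ^ 2 := by
  have h0 := stageBlocks_pos hj
  have h1 : 2 ^ j / (4718592 * stageBlocks j) < (stageScale j + 1) * (stageScale j + 1) :=
    Nat.sqrt_lt.mp (Nat.lt_succ_self _)
  have h2 := stageScale_ge hj
  rw [Nat.div_lt_iff_lt_mul (by positivity)] at h1
  have h3 : (stageScale j + 1) * (stageScale j + 1) ≤ 4 * stageScale j ^ 2 := by nlinarith
  have h4 := h1.le.trans (Nat.mul_le_mul_right _ h3)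
  rw [pow_succ]
  nlinarith

lemma loglog_bounds {j : ℕ} (hj : 64 ≤ j) :
    (stageBlocks j : ℝ) ≤ Real.log (Real.log ((2 ^ (j + 1) : ℕ) : ℝ)) ∧
      Real.log (Real.log ((2 ^ (j + 1) : ℕ) : ℝ)) ≤ 8 * stageBlocks j := by
  have h0 : (1 : ℝ) ≤ stageBlocks j := by exact_mod_cast stageBlocks_pos hj
  have hj' : (64 : ℝ) ≤ j := by exact_mod_cast hj
  have hlog : Real.log ((2 ^ (j + 1) : ℕ) : ℝ) = (j + 1) * Real.log 2 := by
    push_cast; rw [Real.log_pow]; push_cast; ring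
  have hl2 : (0.6931471803 : ℝ) < Real.log 2 := Real.log_two_gt_d9
  have hl2' : Real.log 2 < (0.6931471808 : ℝ) := Real.log_two_lt_d9
  have hlog48 : Real.log 48 ≤ 4 := by
    have h : Real.log ((48 : ℝ) ^ 5) ≤ Real.log ((2 : ℝ) ^ 28) :=
      Real.log_le_log (by norm_num) (by norm_num)
    rw [Real.log_pow, Real.log_pow] at h
    push_cast at h
    linarith
  have hlog48' : 2 ≤ Real.log 48 := by
    have h : Real.log ((2 : ℝ) ^ 5) ≤ Real.log 48 :=
      Real.log_le_log (by norm_num) (by norm_num)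
    rw [Real.log_pow] at h
    push_cast at h
    linarith
  rw [hlog]
  constructor
  · have h1 : 48 ^ stageBlocks j ≤ j := Nat.pow_log_le_self 48 (by omega)
    have h2 : (stageBlocks j : ℝ) * Real.log 48 ≤ Real.log j := by
      rw [← Real.log_pow]
      exact Real.log_le_log (by positivity) (by exact_mod_cast h1)
    have h3 : Real.log j ≤ 2 * Real.log ((j + 1) * Real.log 2) := by
      have : Real.log ((((j : ℝ) + 1) * Real.log 2) ^ 2) = 2 * Real.log ((j + 1) * Real.log 2) := by
        rw [Real.log_pow]; norm_num
      rw [← this]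
      refine Real.log_le_log (by positivity) ?_
      have : (j : ℝ) / 2 ≤ (j + 1) * Real.log 2 := by nlinarith
      nlinarith
    nlinarith
  · have h1 : j < 48 ^ (stageBlocks j + 1) := Nat.lt_pow_succ_log_self (by norm_num) j
    have h2 : Real.log ((j + 1) * Real.log 2) ≤ (stageBlocks j + 1 : ℕ) * Real.log 48 := by
      rw [← Real.log_pow]
      refine Real.log_le_log (by positivity) ?_
      calc ((j : ℝ) + 1) * Real.log 2 ≤ (j + 1) * 1 := by gcongr; linarith
        _ ≤ _ := by rw [mul_one]; exact_mod_cast h1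
    push_cast at h2
    nlinarith

/-- The base `48` in `stageBlocks` matches the probability `1/48` of a block. -/
lemma wordProb_stage_ge {j : ℕ} (hj : 64 ≤ j) :
    1 / (j : ℝ) ≤ wordProb (stageBlocks j * blockLength (stageScale j))
      (climbingBlocks (stageScale j) (stageBlocks j)) := by
  refine le_trans ?_ (wordProb_climbingBlocks_ge (stageScale_ge hj) _)
  have h1 : 48 ^ stageBlocks j ≤ j := Nat.pow_log_le_self 48 (by omega)
  rw [one_div_pow]
  gcongr
  exact_mod_cast h1

lemma ae_frequently_climbingBlocks {Ω : Type*} [MeasurableSpace Ω] {P : Measure Ω}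
    [IsProbabilityMeasure P] {S : ℕ → Ω → ℤ} (hS : IsSimpleRandomWalk P S) :
    ∀ᵐ ω ∂P, ∃ᶠ j in atTop, stepWord (fun t => S t ω) (2 ^ j)
      (stageBlocks j * blockLength (stageScale j)) ∈
        climbingBlocks (stageScale j) (stageBlocks j) := by
  set E : ℕ → Set Ω := fun j => {ω | stepWord (fun t => S t ω) (2 ^ j)
      (stageBlocks j * blockLength (stageScale j)) ∈
        climbingBlocks (stageScale j) (stageBlocks j)} with hE
  have hmeas : ∀ j, MeasurableSet (E j) := fun j =>
    (iSup₂_le fun i _ => stepSigma_le hS i) _ (measurableSet_stepWord (2 ^ j) _ _)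
  have hind : iIndepSet E P := by
    -- A stage uses at most `2 ^ j` steps after time `2 ^ j`, so distinct stages depend on disjoint
    -- sets of steps.
    refine iIndepSet_of_measurableSet_iSup (stepSigma_le hS) (iIndep_stepSigma hS)
      (fun j => Set.Ico (2 ^ j) (2 ^ j + stageBlocks j * blockLength (stageScale j))) ?_
      fun j => measurableSet_stepWord (2 ^ j) _ _
    have hlt : ∀ a b : ℕ, a < b →
        Disjoint (Set.Ico (2 ^ a) (2 ^ a + stageBlocks a * blockLength (stageScale a)))
        (Set.Ico (2 ^ b) (2 ^ b + stageBlocks b * blockLength (stageScale b))) := by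
      intro a b hab
      rw [Set.disjoint_left]
      intro i h1 h2
      have h3 := stage_length_le a
      have h4 : 2 ^ (a + 1) ≤ 2 ^ b := Nat.pow_le_pow_right (by norm_num) hab
      rw [pow_succ] at h4
      simp only [Set.mem_Ico] at h1 h2
      omega
    intro a b hab
    rcases lt_or_gt_of_ne hab with h | h
    · exact hlt a b h
    · exact (hlt b a h).symm
  have htsum : ∑' j, P (E j) = ⊤ := by
    by_contra hne
    have hsum := ENNReal.summable_toReal hne
    refine Real.not_summable_one_div_natCast (Summable.of_norm_bounded_eventually_nat hsum ?_)
    filter_upwards [eventually_ge_atTop 64] with j hj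
    rw [Real.norm_of_nonneg (by positivity)]
    exact (wordProb_stage_ge hj).trans_eq (measureReal_stepWord hS _ _ _).symm
  have hone := measure_limsup_eq_one hmeas hind htsum
  have hae := (mem_ae_iff_prob_eq_one (MeasurableSet.measurableSet_limsup hmeas)).2 hone
  filter_upwards [hae] with ω hω
  exact mem_limsup_iff_frequently_mem.mp hω

/-! ### Constants and conclusion -/

lemma truncatedSum_ge_of_climbingBlocks {s : ℕ → ℤ}
    (hs : ∀ t, s (t + 1) - s t = 1 ∨ s (t + 1) - s t = -1) {j : ℕ} (hj : 64 ≤ j)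
    (hw : stepWord s (2 ^ j) (stageBlocks j * blockLength (stageScale j)) ∈
      climbingBlocks (stageScale j) (stageBlocks j)) {n : ℕ} (hn : n = 2 ^ (j + 1)) {k : ℕ} {l : ℝ}
    (hk : 1 ≤ k) (hl : 0 ≤ l)
    (hkn : (k : ℝ) ≤ 1 / (2 ^ 13 * 6144) * Real.sqrt n / (2 * Real.sqrt (Real.log (Real.log n)))) :
    1 / 10 ^ 7 * min ((n : ℝ) / k) (Real.sqrt (n * Real.log (Real.log n)) * l) ≤
      truncatedSum s k n l := by
  have hlen := stage_length_le j
  have hnn : (n : ℝ) ≤ 37748736 * stageBlocks j * stageScale j ^ 2 := by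
    rw [hn]; exact_mod_cast two_pow_succ_le hj
  have hll := loglog_bounds hj
  rw [← hn] at hll
  obtain ⟨X, -, hX, hrich⟩ := exists_richPoints_of_climbingBlocks hs (n := n)
    (by rw [hn, pow_succ]; omega) hw
  have hq : (1 : ℝ) ≤ stageBlocks j := by exact_mod_cast stageBlocks_pos hj
  have hX' : 384 * ((stageBlocks j : ℝ) * stageScale j) ≤ X.card := by
    have : (stageBlocks j : ℝ) * (768 * stageScale j) ≤ 2 * X.card := by exact_mod_cast hX
    linarith
  have hN : (0 : ℝ) ≤ stageScale j := Nat.cast_nonneg _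
  have hk' : (0 : ℝ) < k := by exact_mod_cast hk
  have hn0 : (0 : ℝ) ≤ n := Nat.cast_nonneg _
  generalize Real.log (Real.log n) = LL at *
  generalize stageScale j = N at *
  generalize (stageBlocks j : ℝ) = q at *
  obtain ⟨hll1, hll2⟩ := hll
  have hLL : 0 < LL := by linarith
  -- `6144 ^ 2 = 37748736` gives `√n ≤ 6144 * N * √LL`; the constant `1 / (2 ^ 13 * 6144)` is chosen
  -- to turn this into richness at depth `k`.
  have hkN : 2 ^ 14 * k ≤ N := by
    have hsqrt : 0 < Real.sqrt LL := Real.sqrt_pos.2 hLL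
    have h1 : Real.sqrt n ≤ 6144 * N * Real.sqrt LL := by
      rw [Real.sqrt_le_left (by positivity), mul_pow, Real.sq_sqrt hLL.le]
      nlinarith [mul_le_mul_of_nonneg_left hll1 (sq_nonneg (N : ℝ))]
    have h2 : (2 : ℝ) ^ 14 * k ≤ N := by
      rw [le_div_iff₀ (by positivity)] at hkn
      have h3 : (2 : ℝ) ^ 14 * k * Real.sqrt LL ≤ N * Real.sqrt LL := by linarith
      exact le_of_mul_le_mul_right h3 hsqrt
    exact_mod_cast h2
  refine le_trans ?_ (card_mul_min_le_truncatedSum hl hk hkN hrich)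
  refine le_trans ?_ (mul_le_mul_of_nonneg_right hX' (le_min (by positivity) hl))
  rcases min_cases ((N : ℝ) / (16 * k)) l with ⟨h, -⟩ | ⟨h, -⟩
  · rw [h]
    calc _ ≤ 1 / 10 ^ 7 * ((n : ℝ) / k) := by gcongr; exact min_le_left _ _
      _ ≤ 1 / 10 ^ 7 * ((37748736 * q * N ^ 2) / k) := by gcongr
      _ = 3.7748736 * (q * N ^ 2 / k) := by ring
      _ ≤ 24 * (q * N ^ 2 / k) := by gcongr; norm_num
      _ = _ := by ring
  · rw [h]
    -- `18432 ^ 2 ≥ 8 * 37748736`.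
    have h1 : Real.sqrt (n * LL) ≤ 18432 * (q * N) := by
      rw [Real.sqrt_le_left (by positivity)]
      calc (n : ℝ) * LL ≤ (37748736 * q * N ^ 2) * (8 * q) := by gcongr
        _ ≤ _ := by nlinarith [sq_nonneg (q * (N : ℝ))]
    calc _ ≤ 1 / 10 ^ 7 * (Real.sqrt (n * LL) * l) := by gcongr; exact min_le_right _ _
      _ ≤ 1 / 10 ^ 7 * (18432 * (q * N) * l) := by gcongr
      _ = 0.0018432 * (q * N * l) := by ring
      _ ≤ 384 * (q * N * l) := by gcongr; norm_num
      _ = _ := by ring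

theorem corollary7p4 :
    ∃ d₃ : ℝ, 0 < d₃ ∧ ∃ c₃ : ℝ, 0 < c₃ ∧
      ∀ (Ω : Type*) [MeasurableSpace Ω] (P : Measure Ω) [IsProbabilityMeasure P]
        (S : ℕ → Ω → ℤ), IsSimpleRandomWalk P S →
        ∀ᵐ ω ∂P, ∃ᶠ n : ℕ in atTop, ∀ (k : ℕ) (l : ℝ), 1 ≤ k → 0 ≤ l →
          (k : ℝ) ≤ d₃ * Real.sqrt n / (2 * Real.sqrt (Real.log (Real.log n))) →
          c₃ * min ((n : ℝ) / k) (Real.sqrt (n * Real.log (Real.log n)) * l) ≤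
            truncatedSum (fun t => S t ω) k n l := by
  refine ⟨1 / (2 ^ 13 * 6144), by positivity, 1 / 10 ^ 7, by positivity, ?_⟩
  intro Ω _ P _ S hS
  filter_upwards [ae_forall_step hS, ae_frequently_climbingBlocks hS] with ω hstep hfreq
  have htend : Tendsto (fun j : ℕ => 2 ^ (j + 1)) atTop atTop :=
    (tendsto_pow_atTop_atTop_of_one_lt one_lt_two).comp (tendsto_add_atTop_nat 1)
  refine htend.frequently ((hfreq.and_eventually (eventually_ge_atTop 64)).mono ?_)
  rintro j ⟨hw, hj⟩ k l hk hl hkn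
  exact truncatedSum_ge_of_climbingBlocks hstep hj hw rfl hk hl hkn
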